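/- Let $X\subseteq\mathbb R^2$ be any subset with the subspace topology, and let $U\subset\mathbb R^2$ be a closed disk, i.e. a subset of the plane homeomorphic to the closed unit disk, whose boundary $\partial U$ is not contained in $X$. Let $\alpha:[0,1]\to X$ be a loop whose image lies in $X\cap\operatorname{int}(U)$ and which is essential in $X$, i.e. $\alpha$ is not homotopic in $X$, relative to its endpoints, to the constant loop at its base point. Then $\alpha$ cannot be freely homotoped in $X$ out of $U\cap X$: there is no loop $\beta:[0,1]\to X$ with image disjoint from $U$ for which there is a continuous map $H:[0,1]\times[0,1]\to X$ with $H(0,t)=\alpha(t)$, $H(1,t)=\beta(t)$ and $H(s,0)=H(s,1)$ for all $s,t\in[0,1]$. -/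

import Mathlib

open scoped unitInterval

/-- The plane `ℝ²` with its Euclidean topology. -/
abbrev Plane : Type := EuclideanSpace ℝ (Fin 2)

/-- A closed (topological) disk in the plane: a subset homeomorphic to the closed unit disk.
Its boundary (image of the unit circle) and interior (image of the open unit disk) are, by
invariance of domain, its topological frontier and interior in the plane. -/
def IsClosedDisk (U : Set Plane) : Prop :=
  Nonempty (U ≃ₜ Metric.closedBall (0 : Plane) 1)

/-- A loop is essential if it is not null-homotopic, i.e. not homotopic relative to its endpoints
to the constant loop at its base point. -/
def IsEssential {X : Type*} [TopologicalSpace X] {x : X} (α : Path x x) : Prop :=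
  ¬ α.Homotopic (Path.refl x)

/-- Two loops, possibly with different base points, are freely homotopic if there is a homotopy
between them each of whose stages is a loop (whose base point may move). -/
def FreelyHomotopic {X : Type*} [TopologicalSpace X] {x y : X} (α : Path x x) (β : Path y y) :
    Prop :=
  ContinuousMap.HomotopicWith (α : C(I, X)) (β : C(I, X)) fun f => f 0 = f 1

open Set Topology

/-! Read a free homotopy as a map F on the annulus 1/2 ≤ |z| ≤ 1, with α on the outer circle, and
extend F to the plane. The points of the annulus sent to the frontier of U separate 1 from 0; by
`IsCompact.exists_isPreconnected_separator` a connected closed subset C already does. F maps C into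
X and the frontier of U, so it misses a point p outside X, and the frontier without p is
parametrized by the line. Thus F on C amounts to a real function whose range is an interval; by
Tietze it extends to the plane without new values, hence inside X. Using this extension off the
component of 1 gives a map from the plane to X restricting to α on the unit circle, so α is
null-homotopic. -/

/-! ### Logarithms and separation of points by closed sets -/

/-- A nonvanishing complex function on a simply connected, locally path connected space has a
continuous logarithm. -/
theorem ContinuousMap.exists_exp_comp_eq {E : Type*} [TopologicalSpace E] [SimplyConnectedSpace E]
    [LocallyPathConnectedSpace E] (g : C(E, ℂ)) (hg : ∀ x, g x ≠ 0) :
    ∃ L : C(E, ℂ), ∀ x, Complex.exp (L x) = g x := by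
  obtain ⟨a⟩ : Nonempty E := inferInstance
  obtain ⟨L, ⟨-, hL⟩, -⟩ := Complex.isCoveringMapOn_exp.existsUnique_continuousMap_lifts g
    (Complex.exp_log (hg a)) hg
  exact ⟨L, fun x => congrFun hL x⟩

/-- A continuous function on a preconnected space whose exponential is constant is constant. -/
theorem eq_of_exp_comp_const {A : Type*} [TopologicalSpace A] [PreconnectedSpace A] {h : A → ℂ}
    (hc : Continuous h) {c : ℂ} (he : ∀ x, Complex.exp (h x) = c) (x y : A) : h x = h y :=
  Complex.isCoveringMap_exp.const_of_comp hc (fun a b => Subtype.ext ((he a).trans (he b).symm)) x y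

theorem JoinedIn.eq_of_exp_comp_const {E : Type*} [TopologicalSpace E] {F : Set E} {a b : E}
    (hab : JoinedIn F a b) {h : E → ℂ} (hc : ContinuousOn h F) {c : ℂ}
    (he : ∀ x, Complex.exp (h x) = c) : h a = h b := by
  obtain ⟨γ, hγ⟩ := hab
  have := _root_.eq_of_exp_comp_const (h := fun t => h (γ t)) (c := c)
    (hc.comp_continuous γ.continuous hγ) (fun t => he _) 0 1
  simpa using this

theorem IsOpen.frontier_pathComponentIn_subset {E : Type*} [TopologicalSpace E]
    [LocallyPathConnectedSpace E] {F : Set E} (hF : IsOpen F) (a : E) :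
    frontier (pathComponentIn F a) ⊆ Fᶜ := by
  intro z hz hzF
  obtain ⟨y, hy, hya⟩ := mem_closure_iff.1 hz.1 _ (hF.pathComponentIn z) (mem_pathComponentIn_self hzF)
  refine hz.2 ?_
  rw [(hF.pathComponentIn a).interior_eq]
  exact JoinedIn.trans hya (JoinedIn.symm hy)

/-- In a simply connected space, if neither of two disjoint closed sets separates two points, then
neither does their union. -/
theorem JoinedIn.compl_union {E : Type*} [TopologicalSpace E] [SimplyConnectedSpace E]
    [LocallyPathConnectedSpace E] [NormalSpace E] {C₁ C₂ : Set E} (h₁ : IsClosed C₁)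
    (h₂ : IsClosed C₂) (hd : Disjoint C₁ C₂) {a b : E} (hab₁ : JoinedIn C₁ᶜ a b)
    (hab₂ : JoinedIn C₂ᶜ a b) : JoinedIn (C₁ ∪ C₂)ᶜ a b := by
  classical
  by_contra hn
  have hF : IsOpen (C₁ ∪ C₂)ᶜ := (h₁.union h₂).isOpen_compl
  set V := pathComponentIn (C₁ ∪ C₂)ᶜ a with hV
  have haV : a ∈ V := mem_pathComponentIn_self
    (by rw [Set.compl_union]; exact ⟨hab₁.source_mem, hab₂.source_mem⟩)
  have hbV : b ∉ V := hn
  have hfr : ∀ z ∈ frontier V, z ∈ C₁ ∨ z ∈ C₂ := fun z hz => by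
    simpa [or_iff_not_imp_left] using hF.frontier_pathComponentIn_subset a hz
  obtain ⟨l, hl₂, hl₁, -⟩ := exists_continuous_zero_one_of_isClosed h₂ h₁ hd.symm
  let w : E → ℂ := fun z => 2 * Real.pi * Complex.I * (l z : ℂ)
  have hw : Continuous w := by fun_prop
  have hw₁ : ∀ z ∈ C₁, w z = 2 * Real.pi * Complex.I := fun z hz => by simp [w, hl₁ hz]
  have hw₂ : ∀ z ∈ C₂, w z = 0 := fun z hz => by simp [w, hl₂ hz]
  -- The pieces agree on the frontier of V, where `w` is 0 or 2πi.
  let g : C(E, ℂ) := ⟨fun z => if z ∈ V then Complex.exp (w z) else 1, by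
    refine Continuous.if (fun z hz => ?_) (by fun_prop) (by fun_prop)
    rcases hfr z hz with h | h
    · simp [hw₁ z h]
    · simp [hw₂ z h]⟩
  obtain ⟨L, hL⟩ := g.exists_exp_comp_eq (fun z => by
    change (if z ∈ V then Complex.exp (w z) else 1) ≠ 0
    split_ifs
    · exact Complex.exp_ne_zero _
    · exact one_ne_zero)
  have hL' : ∀ z, Complex.exp (L z) = if z ∈ V then Complex.exp (w z) else 1 := hL
  -- Two logarithms of 1: this one is continuous off C₁, the one in `e₂` off C₂. They differ by 2πi
  -- at `a` and agree at `b`.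
  have e₁ : (if a ∈ V then L a - w a else L a) = if b ∈ V then L b - w b else L b := by
    refine hab₁.eq_of_exp_comp_const (h := fun z => if z ∈ V then L z - w z else L z) (c := 1)
      ?_ ?_
    · refine ContinuousOn.if (fun z hz => ?_) (by fun_prop) (by fun_prop)
      rw [hw₂ z ((hfr z hz.2).resolve_left hz.1), sub_zero]
    · intro z
      have := hL' z
      split_ifs at this ⊢
      · rw [Complex.exp_sub, this, div_self (Complex.exp_ne_zero _)]
      · exact this
  have e₂ : (if a ∈ V then L a - w a + 2 * Real.pi * Complex.I else L a)
      = if b ∈ V then L b - w b + 2 * Real.pi * Complex.I else L b := by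
    refine hab₂.eq_of_exp_comp_const
      (h := fun z => if z ∈ V then L z - w z + 2 * Real.pi * Complex.I else L z) (c := 1) ?_ ?_
    · refine ContinuousOn.if (fun z hz => ?_) (by fun_prop) (by fun_prop)
      rw [hw₁ z ((hfr z hz.2).resolve_right hz.1), sub_add_cancel]
    · intro z
      have := hL' z
      split_ifs at this ⊢
      · rw [Complex.exp_add, Complex.exp_two_pi_mul_I, Complex.exp_sub, this,
          div_self (Complex.exp_ne_zero _), one_mul]
      · exact this
  rw [if_pos haV, if_neg hbV] at e₁ e₂
  rw [e₁] at e₂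
  exact Complex.two_pi_I_ne_zero (add_eq_left.1 e₂)

/-- A compact set separating two points contains a minimal closed set separating them, and such a
minimal set is connected. -/
theorem IsCompact.exists_isPreconnected_separator {E : Type*} [TopologicalSpace E]
    [SimplyConnectedSpace E] [LocallyPathConnectedSpace E] [T2Space E] [NormalSpace E] {K : Set E}
    (hK : IsCompact K) {a b : E} (hab : ¬ JoinedIn Kᶜ a b) :
    ∃ C ⊆ K, IsClosed C ∧ IsPreconnected C ∧ ¬ JoinedIn Cᶜ a b := by
  let S : Set (Set E) := {D | IsClosed D ∧ D ⊆ K ∧ ¬ JoinedIn Dᶜ a b}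
  obtain ⟨C, -, hC⟩ := zorn_superset_nonempty S (by
    intro c hcS hc hne
    refine ⟨⋂₀ c, ⟨isClosed_sInter fun D hD => (hcS hD).1, ?_, ?_⟩, fun s hs => sInter_subset_of_mem hs⟩
    · obtain ⟨D, hD⟩ := hne
      exact (sInter_subset_of_mem hD).trans (hcS hD).2.1
    · rintro ⟨γ, hγ⟩
      -- By compactness, a path missing the intersection of the chain misses a member.
      have hP : IsCompact (range γ) := isCompact_range γ.continuous
      have : Nonempty c := hne.to_subtype
      obtain ⟨D, hD⟩ := hP.elim_directed_family_closed (fun D : c => (D : Set E))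
        (fun D => (hcS D.2).1) (by
          rw [← sInter_eq_iInter, ← disjoint_iff_inter_eq_empty, disjoint_left]
          rintro _ ⟨t, rfl⟩
          exact hγ t)
        (fun x y => (hc.total x.2 y.2).elim (fun h => ⟨x, subset_rfl, h⟩)
          (fun h => ⟨y, h, subset_rfl⟩))
      refine (hcS D.2).2.2 ⟨γ, fun t ht => ?_⟩
      exact (disjoint_iff_inter_eq_empty.2 hD).le_bot ⟨mem_range_self t, ht⟩) K
    ⟨hK.isClosed, subset_rfl, hab⟩
  obtain ⟨⟨hCc, hCK, hCab⟩, hmin⟩ := hC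
  refine ⟨C, hCK, hCc, ?_, hCab⟩
  rw [isPreconnected_iff_subset_of_fully_disjoint_closed hCc]
  intro u v hu hv huv hd
  have key : ∀ w, IsClosed w → ¬ JoinedIn (C ∩ w)ᶜ a b → C ⊆ w := fun w hw hn =>
    (hmin (y := C ∩ w) ⟨hCc.inter hw, inter_subset_left.trans hCK, hn⟩ inter_subset_left).trans
      inter_subset_right
  by_contra! hcon
  refine hCab ?_
  rw [← inter_eq_left.2 huv, inter_union_distrib_left]
  exact JoinedIn.compl_union (hCc.inter hu) (hCc.inter hv)
    (hd.mono inter_subset_right inter_subset_right)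
    (not_not.1 fun h => hcon.1 (key u hu h)) (not_not.1 fun h => hcon.2 (key v hv h))

/-! ### Winding numbers and invariance of domain -/

/-- A `2π`-periodic complex function has a continuous `2π`-periodic logarithm, that is, it winds
zero times about the origin. -/
def HasPeriodicLog (γ : ℝ → ℂ) : Prop :=
  ∃ L : ℝ → ℂ, Continuous L ∧ (∀ θ, Complex.exp (L θ) = γ θ) ∧ ∀ θ, L (θ + 2 * Real.pi) = L θ

/-- Lift the whole homotopy to a logarithm: its increment over a period has exponential 1, so it is
constant, and it vanishes at stage `s`. -/
theorem HasPeriodicLog.congr_homotopy {Φ : I → ℝ → ℂ} (hΦ : Continuous fun p : I × ℝ => Φ p.1 p.2)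
    (h0 : ∀ s θ, Φ s θ ≠ 0) (hper : ∀ s θ, Φ s (θ + 2 * Real.pi) = Φ s θ) {s : I}
    (hs : HasPeriodicLog (Φ s)) (s' : I) : HasPeriodicLog (Φ s') := by
  let P : ℝ → I := projIcc 0 1 zero_le_one
  have hP : Continuous P := continuous_projIcc
  obtain ⟨L, hL⟩ := (ContinuousMap.mk (fun p : ℝ × ℝ => Φ (P p.1) p.2)
    (hΦ.comp (f := fun p : ℝ × ℝ => (P p.1, p.2)) (by fun_prop))).exists_exp_comp_eq
    (fun p => h0 _ _)
  replace hL : ∀ r θ, Complex.exp (L (r, θ)) = Φ (P r) θ := fun r θ => hL (r, θ)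
  obtain ⟨M, hM, hMe, hMp⟩ := hs
  have hPs : ∀ s : I, P s = s := fun s => projIcc_val zero_le_one s
  have e : L ((s : ℝ), 2 * Real.pi) - M (2 * Real.pi) = L ((s : ℝ), 0) - M 0 :=
    eq_of_exp_comp_const (h := fun θ : ℝ => L ((s : ℝ), θ) - M θ) (c := 1) (by fun_prop)
      (fun θ => by
        rw [Complex.exp_sub, hL, hMe, hPs, div_self (h0 _ _)]) _ _
  have hM0 : M (2 * Real.pi) = M 0 := by simpa using hMp 0
  have e0 : L ((s : ℝ), 0 + 2 * Real.pi) - L ((s : ℝ), 0) = 0 := by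
    rw [zero_add]; linear_combination e + hM0
  refine ⟨fun θ => L ((s' : ℝ), θ), by fun_prop, fun θ => by rw [hL, hPs], fun θ => ?_⟩
  have := eq_of_exp_comp_const (h := fun p : ℝ × ℝ => L (p.1, p.2 + 2 * Real.pi) - L p) (c := 1)
    (by fun_prop) (fun p => by
      rw [Complex.exp_sub, hL, hper, ← hL, div_self (Complex.exp_ne_zero _)]) ((s' : ℝ), θ)
      ((s : ℝ), 0)
  exact sub_eq_zero.1 (this.trans e0)

/-- The increment of a logarithm over π is a constant with exponential -1, but periodicity makes
twice it zero. -/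
theorem not_hasPeriodicLog_of_odd {γ : ℝ → ℂ} (hγ : ∀ θ, γ (θ + Real.pi) = - γ θ) :
    ¬ HasPeriodicLog γ := by
  rintro ⟨L, hL, hLe, hLp⟩
  have hne : ∀ θ, γ θ ≠ 0 := fun θ => hLe θ ▸ Complex.exp_ne_zero _
  have he : ∀ θ, Complex.exp (L (θ + Real.pi) - L θ) = -1 := fun θ => by
    rw [Complex.exp_sub, hLe, hLe, hγ, neg_div, div_self (hne θ)]
  have e : L (Real.pi + Real.pi) - L Real.pi = L (0 + Real.pi) - L 0 :=
    eq_of_exp_comp_const (h := fun θ : ℝ => L (θ + Real.pi) - L θ) (c := -1) (by fun_prop) he _ _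
  have hp := hLp 0
  rw [zero_add, two_mul] at hp
  have h0 := he 0
  rw [zero_add] at e h0
  have : L Real.pi - L 0 = 0 := by linear_combination (-1 / 2 : ℂ) * e + (1 / 2 : ℂ) * hp
  rw [this, Complex.exp_zero] at h0
  norm_num at h0

/-- Otherwise some `c` near `f z` is not a value. Shrinking the circle shows that its image winds
zero times about `c`, hence about `f z`; but that loop deforms to an odd one. -/
theorem mem_interior_image_closedBall {f : ℂ → ℂ} {z : ℂ} {r : ℝ} (hr : 0 < r)
    (hf : ContinuousOn f (Metric.closedBall z r)) (hinj : InjOn f (Metric.closedBall z r)) :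
    f z ∈ interior (f '' Metric.closedBall z r) := by
  by_contra hint
  have hE : ∀ θ : ℝ, ‖Complex.exp (θ * Complex.I)‖ = 1 := Complex.norm_exp_ofReal_mul_I
  have hper : ∀ θ : ℝ, Complex.exp (((θ + 2 * Real.pi : ℝ) : ℂ) * Complex.I)
      = Complex.exp (θ * Complex.I) := fun θ => by
    push_cast; rw [add_mul, Complex.exp_add, Complex.exp_two_pi_mul_I, mul_one]
  have hodd : ∀ θ : ℝ, Complex.exp (((θ + Real.pi : ℝ) : ℂ) * Complex.I)
      = - Complex.exp (θ * Complex.I) := fun θ => by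
    push_cast; rw [add_mul, Complex.exp_add, Complex.exp_pi_mul_I, mul_neg_one]
  have hmem : ∀ (t θ : ℝ), |t| ≤ 1 →
      z + (t * r : ℝ) * Complex.exp (θ * Complex.I) ∈ Metric.closedBall z r := fun t θ ht => by
    rw [Metric.mem_closedBall, dist_eq_norm, add_sub_cancel_left, norm_mul, hE, mul_one,
      Complex.norm_real, Real.norm_eq_abs, abs_mul, abs_of_pos hr]
    exact mul_le_of_le_one_left hr.le ht
  have hcont : ∀ τ : I → ℝ, Continuous τ → (∀ s, |τ s| ≤ 1) → Continuous fun p : I × ℝ =>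
      f (z + (τ p.1 * r : ℝ) * Complex.exp (p.2 * Complex.I)) := fun τ hτ hτ1 =>
    hf.comp_continuous (by fun_prop) (fun p => hmem _ _ (hτ1 _))
  have hz : z ∈ Metric.closedBall z r := Metric.mem_closedBall_self hr.le
  have hS : IsCompact (f '' Metric.sphere z r) :=
    (isCompact_sphere z r).image_of_continuousOn (hf.mono Metric.sphere_subset_closedBall)
  have hpS : f z ∈ (f '' Metric.sphere z r)ᶜ := by
    rintro ⟨w, hw, hwz⟩
    have := hinj (Metric.sphere_subset_closedBall hw) hz hwz
    rw [this, Metric.mem_sphere, dist_self] at hw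
    exact hr.ne hw
  obtain ⟨δ, hδ, hball⟩ := Metric.isOpen_iff.1 hS.isClosed.isOpen_compl _ hpS
  obtain ⟨c, hcU, hcδ⟩ : ∃ c, c ∉ f '' Metric.closedBall z r ∧ dist c (f z) < δ := by
    rw [mem_interior_iff_mem_nhds, Metric.mem_nhds_iff] at hint
    push Not at hint
    obtain ⟨c, hc, hcU⟩ := not_subset.1 (hint δ hδ)
    exact ⟨c, hcU, hc⟩
  have h₁ : HasPeriodicLog fun θ : ℝ =>
      f (z + ((1 : ℝ) * r : ℝ) * Complex.exp (θ * Complex.I)) - c := by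
    have hτ : ∀ s : I, |(s : ℝ)| ≤ 1 := fun s => by rw [abs_of_nonneg s.2.1]; exact s.2.2
    refine HasPeriodicLog.congr_homotopy
      (Φ := fun s θ => f (z + ((s : ℝ) * r : ℝ) * Complex.exp (θ * Complex.I)) - c)
      ((hcont _ continuous_subtype_val hτ).sub continuous_const) (fun s θ h => hcU ?_)
      (fun s θ => by simp only [hper]) (s := 0) ?_ 1
    · exact ⟨_, hmem _ _ (hτ s), sub_eq_zero.1 h⟩
    · refine ⟨fun _ => Complex.log (f z - c), continuous_const, fun θ => ?_, fun _ => rfl⟩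
      rw [Complex.exp_log]
      · simp
      · exact fun h => hcU ⟨z, hz, sub_eq_zero.1 h⟩
  have h₂ : HasPeriodicLog fun θ : ℝ =>
      f (z + ((1 : ℝ) * r : ℝ) * Complex.exp (θ * Complex.I)) - f z := by
    have := HasPeriodicLog.congr_homotopy
      (Φ := fun s θ => f (z + ((1 : ℝ) * r : ℝ) * Complex.exp (θ * Complex.I))
        - (c + ((s : ℝ) : ℂ) * (f z - c)))
      ((hcont (fun _ => 1) continuous_const (fun _ => by simp)).sub (by fun_prop))
      (fun s θ h => ?_) (fun s θ => by simp only [hper]) (s := 0) (by simpa using h₁) 1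
    · simpa using this
    · have h' := sub_eq_zero.1 h
      have hb : f (z + ((1 : ℝ) * r : ℝ) * Complex.exp (θ * Complex.I)) ∈ Metric.ball (f z) δ := by
        rw [h', Metric.mem_ball, dist_eq_norm]
        have : c + ((s : ℝ) : ℂ) * (f z - c) - f z = ((1 - s : ℝ) : ℂ) * (c - f z) := by
          push_cast; ring
        rw [this, norm_mul, Complex.norm_real, Real.norm_eq_abs,
          abs_of_nonneg (sub_nonneg.2 s.2.2), ← dist_eq_norm]
        exact (mul_le_of_le_one_left dist_nonneg (by linarith [s.2.1])).trans_lt hcδ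
      refine hball hb ⟨_, ?_, rfl⟩
      rw [Metric.mem_sphere, dist_eq_norm, add_sub_cancel_left, norm_mul, hE, mul_one,
        Complex.norm_real, Real.norm_eq_abs, one_mul, abs_of_pos hr]
  have ht₁ : ∀ s : I, |1 - (s : ℝ) / 2| ≤ 1 := fun s => by
    rw [abs_le]; constructor <;> linarith [s.2.1, s.2.2]
  have ht₂ : ∀ s : I, |-((s : ℝ) / 2)| ≤ 1 := fun s => by
    rw [abs_le]; constructor <;> linarith [s.2.1, s.2.2]
  -- The two arguments of `f` always differ by r·exp(iθ), so injectivity prevents zeros; at s = 1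
  -- they are antipodal.
  have h₃ := HasPeriodicLog.congr_homotopy
    (Φ := fun s θ => f (z + ((1 - (s : ℝ) / 2) * r : ℝ) * Complex.exp (θ * Complex.I))
      - f (z + (-((s : ℝ) / 2) * r : ℝ) * Complex.exp (θ * Complex.I)))
    ((hcont _ (by fun_prop) ht₁).sub (hcont _ (by fun_prop) ht₂))
    (fun s θ h => ?_) (fun s θ => by simp only [hper]) (s := 0) (by simpa using h₂) 1
  · refine not_hasPeriodicLog_of_odd (fun θ => ?_) h₃
    rw [hodd, neg_sub]
    congr 3 <;> push_cast <;> ring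
  · have e := hinj (hmem _ _ (ht₁ s)) (hmem _ _ (ht₂ s)) (sub_eq_zero.1 h)
    have : (r : ℂ) * Complex.exp (θ * Complex.I) = 0 := by
      push_cast at e
      linear_combination e
    rw [mul_eq_zero] at this
    rcases this with h | h
    · exact hr.ne' (by exact_mod_cast h)
    · exact Complex.exp_ne_zero _ h

/-- Invariance of domain for the closed disk in the plane. -/
theorem image_ball_subset_interior {f : ℂ → ℂ}
    (hf : ContinuousOn f (Metric.closedBall 0 1)) (hinj : InjOn f (Metric.closedBall 0 1)) :
    f '' Metric.ball 0 1 ⊆ interior (f '' Metric.closedBall 0 1) := by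
  rintro _ ⟨z, hz, rfl⟩
  have hsub : Metric.closedBall z (1 - dist z 0) ⊆ Metric.closedBall (0 : ℂ) 1 :=
    Metric.closedBall_subset_closedBall' (by linarith)
  exact interior_mono (image_mono hsub)
    (mem_interior_image_closedBall (sub_pos.2 hz) (hf.mono hsub) (hinj.mono hsub))

/-! ### The frontier of a disk without a point -/

/-- The radial retraction of the plane onto the closed unit disk. -/
noncomputable def unitDiskRetraction (z : ℂ) : ℂ := ((max 1 ‖z‖)⁻¹ : ℝ) • z

theorem continuous_unitDiskRetraction : Continuous unitDiskRetraction := by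
  refine Continuous.smul (Continuous.inv₀ (continuous_const.max continuous_norm) fun z => ?_)
    continuous_id
  exact (zero_lt_one.trans_le (le_max_left _ _)).ne'

theorem unitDiskRetraction_of_norm_le {z : ℂ} (hz : ‖z‖ ≤ 1) : unitDiskRetraction z = z := by
  simp [unitDiskRetraction, max_eq_left hz]

theorem norm_unitDiskRetraction (z : ℂ) : ‖unitDiskRetraction z‖ = (max 1 ‖z‖)⁻¹ * ‖z‖ := by
  rw [unitDiskRetraction, norm_smul, Real.norm_eq_abs, abs_of_nonneg (by positivity)]

theorem norm_unitDiskRetraction_of_le {z : ℂ} (hz : 1 ≤ ‖z‖) : ‖unitDiskRetraction z‖ = 1 := by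
  rw [norm_unitDiskRetraction, max_eq_right hz, inv_mul_cancel₀ (by linarith)]

theorem norm_unitDiskRetraction_le (z : ℂ) : ‖unitDiskRetraction z‖ ≤ 1 := by
  rcases le_total ‖z‖ 1 with h | h
  · rwa [unitDiskRetraction_of_norm_le h]
  · exact (norm_unitDiskRetraction_of_le h).le

/-- The frontier of a closed disk with one point removed is parametrized by the real line. -/
theorem IsClosedDisk.exists_parametrization {U : Set Plane} (hU : IsClosedDisk U) {p : Plane}
    (hp : p ∈ frontier U) :
    ∃ (l : ↥(frontier U \ {p}) → ℝ) (c : ℝ → Plane), Continuous l ∧ Continuous c ∧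
      ∀ y, c (l y) = y := by
  obtain ⟨h⟩ := hU
  let e : ℂ ≃ₗᵢ[ℝ] Plane := Complex.orthonormalBasisOneI.repr
  have hcomp : IsCompact U := by
    have : CompactSpace U := h.symm.compactSpace
    exact isCompact_iff_compactSpace.2 this
  have hfrU : frontier U ⊆ U := hcomp.isClosed.frontier_subset
  have hmem : ∀ z, e (unitDiskRetraction z) ∈ Metric.closedBall (0 : Plane) 1 := fun z => by
    rw [mem_closedBall_zero_iff, e.norm_map]
    exact norm_unitDiskRetraction_le z
  let k : ℂ → Plane := fun z => h.symm ⟨e (unitDiskRetraction z), hmem z⟩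
  have hk : Continuous k := continuous_subtype_val.comp (h.symm.continuous.comp
    ((e.continuous.comp continuous_unitDiskRetraction).subtype_mk _))
  let m : U → ℂ := fun u => e.symm (h u)
  have hm : Continuous m := e.symm.continuous.comp (continuous_subtype_val.comp h.continuous)
  have hm1 : ∀ u, ‖m u‖ ≤ 1 := fun u => by
    rw [e.symm.norm_map]; exact mem_closedBall_zero_iff.1 (h u).2
  have hkm : ∀ u, k (m u) = u := fun u => by
    simp only [k, unitDiskRetraction_of_norm_le (hm1 u)]
    simp [m]
  have hmk : ∀ z (hz : ‖z‖ ≤ 1), m ⟨k z, Subtype.coe_prop _⟩ = z := fun z hz => by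
    simp [m, k, unitDiskRetraction_of_norm_le hz]
  have hinj : InjOn (fun z => e.symm (k z)) (Metric.closedBall 0 1) := fun z hz w hw hzw => by
    rw [mem_closedBall_zero_iff] at hz hw
    have : k z = k w := e.symm.injective hzw
    rw [← hmk z hz, ← hmk w hw]
    simp only [this]
  have himg : (fun z => e.symm (k z)) '' Metric.closedBall 0 1 ⊆ e.symm '' U := by
    rintro _ ⟨z, -, rfl⟩
    exact ⟨k z, Subtype.coe_prop _, rfl⟩
  have hnorm : ∀ y (hy : y ∈ frontier U), ‖m ⟨y, hfrU hy⟩‖ = 1 := fun y hy => by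
    refine (hm1 _).eq_of_not_lt fun hlt => hy.2 ?_
    have := interior_mono himg (image_ball_subset_interior
      (e.symm.continuous.comp hk).continuousOn hinj
      ⟨m ⟨y, hfrU hy⟩, mem_ball_zero_iff.2 hlt, rfl⟩)
    simp only [Function.comp_apply] at this
    rw [show k (m ⟨y, hfrU hy⟩) = y from hkm _, ← e.symm.coe_toHomeomorph, ← Homeomorph.image_interior] at this
    obtain ⟨y', hy', hyy⟩ := this
    rwa [← e.symm.injective hyy]
  set q := m ⟨p, hfrU hp⟩ with hq
  have hq1 : ‖q‖ = 1 := hnorm p hp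
  have hq0 : q ≠ 0 := norm_ne_zero_iff.1 (by rw [hq1]; exact one_ne_zero)
  let m' : ↥(frontier U \ {p}) → ℂ := fun y => m ⟨y, hfrU y.2.1⟩
  have hm' : Continuous m' := hm.comp (continuous_subtype_val.subtype_mk _)
  have hm'1 : ∀ y, ‖-m' y / q‖ = 1 := fun y => by
    rw [norm_div, norm_neg, hq1, hnorm _ y.2.1, div_one]
  -- The sign puts the branch cut of `arg` exactly at `p`.
  refine ⟨fun y => Complex.arg (-m' y / q), fun t => k (-q * Complex.exp (t * Complex.I)), ?_,
    hk.comp (by fun_prop), fun y => ?_⟩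
  · refine continuous_iff_continuousAt.2 fun y =>
      (Complex.continuousAt_arg ?_).comp (hm'.neg.div_const q).continuousAt
    rw [Complex.mem_slitPlane_iff_arg]
    refine ⟨fun harg => y.2.2 ?_, norm_ne_zero_iff.1 (by rw [hm'1]; exact one_ne_zero)⟩
    have h1 := Complex.norm_mul_exp_arg_mul_I (-m' y / q)
    rw [hm'1, harg, Complex.exp_pi_mul_I, eq_div_iff hq0] at h1
    have h2 : m' y = q := by linear_combination (norm := (push_cast; ring)) h1
    have h3 : k (m' y) = k q := by rw [h2]
    rw [hkm, hkm] at h3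
    exact h3
  · have h1 := Complex.norm_mul_exp_arg_mul_I (-m' y / q)
    rw [hm'1, Complex.ofReal_one, one_mul] at h1
    beta_reduce
    rw [h1, neg_mul, mul_div_cancel₀ _ hq0, neg_neg]
    exact hkm _

/-! ### Loops and homotopies as maps of the plane -/

/-- A loop that extends along the unit circle to the whole plane is null-homotopic. -/
theorem Path.Homotopic.refl_of_extends {Y : Type*} [TopologicalSpace Y] {x : Y} (α : Path x x)
    (G : C(ℂ, Y)) (hG : ∀ t : I, G (Complex.exp ((2 * Real.pi * t : ℝ) * Complex.I)) = α t) :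
    α.Homotopic (Path.refl x) := by
  obtain rfl : G 1 = x := by simpa using hG 0
  let c : Path (1 : ℂ) 1 :=
    { toFun := fun t => Complex.exp ((2 * Real.pi * t : ℝ) * Complex.I)
      continuous_toFun := by fun_prop
      source' := by simp
      target' := by simp }
  have := (SimplyConnectedSpace.paths_homotopic c (Path.refl 1)).map G
  convert this using 1
  · ext t
    exact (hG t).symm
  · ext t
    rfl

/-- A free homotopy of loops can be viewed as a map of the plane, with its stages on the circles
of radius between `1` and `1 / 2`, and extended radially outside of the unit disk. -/
theorem exists_radial_extension {Y : Type*} [TopologicalSpace Y] [TietzeExtension.{0} Y]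
    (H : C(I × I, Y)) (hH : ∀ s, H (s, 0) = H (s, 1)) :
    ∃ F : C(ℂ, Y), (∀ s t : I, F (((1 - s / 2 : ℝ) : ℂ) *
      Complex.exp ((2 * Real.pi * t : ℝ) * Complex.I)) = H (s, t)) ∧
      ∀ z, F (unitDiskRetraction z) = F z := by
  let φ : I × I → ℂ := fun p =>
    ((1 - p.1 / 2 : ℝ) : ℂ) * Complex.exp ((2 * Real.pi * p.2 : ℝ) * Complex.I)
  have hφ : Continuous φ := by fun_prop
  have hφn : ∀ p, ‖φ p‖ = 1 - p.1 / 2 := fun p => by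
    rw [norm_mul, Complex.norm_exp_ofReal_mul_I, mul_one, Complex.norm_real, Real.norm_eq_abs,
      abs_of_nonneg (by linarith [p.1.2.2])]
  have hfib : ∀ p p', φ p = φ p' → H p = H p' := by
    rintro ⟨s, t⟩ ⟨s', t'⟩ h
    obtain rfl : s = s' := by
      have := congrArg norm h
      rw [hφn, hφn] at this
      exact Subtype.ext (by linarith)
    have hne : ((1 - s / 2 : ℝ) : ℂ) ≠ 0 :=
      Complex.ofReal_ne_zero.2 (by linarith [s.2.2] : (0 : ℝ) < 1 - s / 2).ne'
    obtain ⟨n, hn⟩ := Complex.exp_eq_exp_iff_exists_int.1 (mul_left_cancel₀ hne h)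
    have hn' : (t : ℝ) = t' + n := by
      have h1 : (2 * Real.pi * Complex.I) * ((t : ℝ) : ℂ)
          = (2 * Real.pi * Complex.I) * ((t' + n : ℝ) : ℂ) := by
        push_cast at hn ⊢
        linear_combination hn
      exact_mod_cast mul_left_cancel₀ Complex.two_pi_I_ne_zero h1
    have hle : (n : ℝ) ≤ 1 := by linarith [t.2.2, t'.2.1]
    have hge : (-1 : ℝ) ≤ n := by linarith [t.2.1, t'.2.2]
    have hle' : n ≤ 1 := by exact_mod_cast hle
    have hge' : -1 ≤ n := by exact_mod_cast hge
    obtain rfl | rfl | rfl : n = -1 ∨ n = 0 ∨ n = 1 := by omega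
    · obtain rfl : t = 0 := Subtype.ext (by push_cast at hn' ⊢; linarith [t.2.1, t'.2.2])
      obtain rfl : t' = 1 := Subtype.ext (by push_cast at hn' ⊢; linarith)
      exact hH s
    · obtain rfl : t = t' := Subtype.ext (by simpa using hn')
      rfl
    · obtain rfl : t' = 0 := Subtype.ext (by push_cast at hn' ⊢; linarith [t.2.2, t'.2.1])
      obtain rfl : t = 1 := Subtype.ext (by push_cast at hn' ⊢; linarith)
      exact (hH s).symm
  -- `H` descends to the annulus; Tietze then fills the inner disk, with values possibly outside X.
  let φr : C(I × I, range φ) := ⟨rangeFactorization φ, hφ.subtype_mk _⟩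
  have hquot : IsQuotientMap φr :=
    φr.continuous.isClosedMap.isQuotientMap φr.continuous rangeFactorization_surjective
  have hfac : Function.FactorsThrough H φr := fun p p' h => hfib p p' (congrArg Subtype.val h)
  let Fr : C(range φ, Y) := hquot.lift H hfac
  obtain ⟨F₀, hF₀⟩ := Fr.exists_restrict_eq (isCompact_range hφ).isClosed
  refine ⟨F₀.comp ⟨unitDiskRetraction, continuous_unitDiskRetraction⟩, fun s t => ?_, fun z => ?_⟩
  · have h1 : unitDiskRetraction (φ (s, t)) = φ (s, t) :=
      unitDiskRetraction_of_norm_le (by rw [hφn]; linarith [s.2.1])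
    change F₀ (unitDiskRetraction (φ (s, t))) = _
    rw [h1]
    have h2 : F₀ (φ (s, t)) = Fr (φr (s, t)) :=
      DFunLike.congr_fun hF₀ (φr (s, t))
    rw [h2]
    exact congrFun (congrArg DFunLike.coe (hquot.lift_comp H hfac)) (s, t)
  · change F₀ (unitDiskRetraction (unitDiskRetraction z)) = F₀ (unitDiskRetraction z)
    rw [unitDiskRetraction_of_norm_le (norm_unitDiskRetraction_le z)]

theorem Complex.exists_eq_norm_mul_exp (z : ℂ) :
    ∃ t : I, z = ‖z‖ * Complex.exp ((2 * Real.pi * t : ℝ) * Complex.I) := by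
  refine ⟨⟨Int.fract (z.arg / (2 * Real.pi)), Int.fract_nonneg _, (Int.fract_lt_one _).le⟩, ?_⟩
  conv_lhs => rw [← Complex.norm_mul_exp_arg_mul_I z]
  congr 1
  rw [Complex.exp_eq_exp_iff_exists_int]
  refine ⟨⌊z.arg / (2 * Real.pi)⌋, ?_⟩
  have h : (z.arg : ℂ) = 2 * Real.pi * ((z.arg / (2 * Real.pi) : ℝ) : ℂ) := by
    push_cast
    field_simp
  have h2 : ((z.arg / (2 * Real.pi) : ℝ) : ℂ)
      = (⌊z.arg / (2 * Real.pi)⌋ : ℂ) + ((Int.fract (z.arg / (2 * Real.pi)) : ℝ) : ℂ) := by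
    exact_mod_cast (Int.floor_add_fract (z.arg / (2 * Real.pi))).symm
  rw [h, h2]
  push_cast
  ring

theorem JoinedIn.exists_mem_frontier {E : Type*} [TopologicalSpace E] {F V : Set E} {a b : E}
    (hab : JoinedIn F a b) (ha : a ∈ V) (hb : b ∉ V) : ∃ z ∈ F, z ∈ frontier V := by
  obtain ⟨γ, hγ⟩ := hab
  obtain ⟨t, ht⟩ : (frontier (γ ⁻¹' V)).Nonempty :=
    nonempty_frontier_iff.2 ⟨⟨0, by simpa using ha⟩, fun h => hb (by
      have := mem_univ (1 : I)
      rw [← h] at this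
      simpa using this)⟩
  exact ⟨γ t, hγ t, γ.continuous.frontier_preimage_subset _ ht⟩

/-! ### Filling in the loop -/

theorem exists_extension_of_separator {U X : Set Plane} {p : Plane} (hU : IsClosedDisk U)
    (hp : p ∈ frontier U) (F : C(ℂ, Plane)) {C : Set ℂ} (hC : IsClosed C) (hCp : IsPreconnected C)
    (hCU : ∀ z ∈ C, F z ∈ frontier U \ {p}) (hCX : ∀ z ∈ C, F z ∈ X) {a b : ℂ}
    (hab : ¬ JoinedIn Cᶜ a b) (hX : ∀ z ∈ pathComponentIn Cᶜ a, F z ∈ X) :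
    ∃ G : C(ℂ, X), ∀ z ∈ pathComponentIn Cᶜ a, (G z : Plane) = F z := by
  classical
  obtain ⟨l, c, hl, hc, hcl⟩ := hU.exists_parametrization hp
  have hfr := hC.isOpen_compl.frontier_pathComponentIn_subset a
  rw [compl_compl] at hfr
  let f : C(C, ℝ) := ⟨fun z => l ⟨F z, hCU z z.2⟩, hl.comp (by fun_prop)⟩
  have hne : (range f).Nonempty := by
    rw [range_nonempty_iff_nonempty]
    by_contra hemp
    rw [not_nonempty_iff, isEmpty_coe_sort] at hemp
    refine hab ?_
    rw [hemp, compl_empty, joinedIn_univ]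
    exact PathConnectedSpace.joined a b
  have : OrdConnected (range f) := by
    have : PreconnectedSpace C := isPreconnected_iff_preconnectedSpace.1 hCp
    exact (isPreconnected_range f.continuous).ordConnected
  -- Keeping `g` within the range of `f`, an interval since C is connected, is what keeps `c (g z)`
  -- in X.
  obtain ⟨g, hg, hgf⟩ := f.exists_extension_forall_mem_of_isClosedEmbedding
    (fun x => mem_range_self x) hne hC.isClosedEmbedding_subtypeVal
  have hcg : ∀ z ∈ C, c (g z) = F z := fun z hz => by
    have : g z = f ⟨z, hz⟩ := congrFun hgf ⟨z, hz⟩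
    rw [this]
    exact hcl _
  have hcX : ∀ z, c (g z) ∈ X := fun z => by
    obtain ⟨w, hw⟩ := hg z
    rw [← hw]
    change c (l _) ∈ X
    rw [hcl]
    exact hCX w w.2
  refine ⟨⟨fun z => ⟨if z ∈ pathComponentIn Cᶜ a then F z else c (g z), ?_⟩, ?_⟩, fun z hz => ?_⟩
  · split_ifs with h
    · exact hX z h
    · exact hcX z
  · refine Continuous.subtype_mk (Continuous.if (fun z hz => (hcg z (hfr hz)).symm) F.continuous
      (hc.comp g.continuous)) _
  · exact if_pos hz

theorem mainTheorem6 (X U : Set Plane) (hU : IsClosedDisk U) (hUX : ¬ frontier U ⊆ X)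
    (x : X) (α : Path x x) (hα : IsEssential α)
    (hαU : ∀ t : I, (α t : Plane) ∈ interior U) :
    ¬ ∃ (y : X) (β : Path y y), (∀ t : I, (β t : Plane) ∉ U) ∧ FreelyHomotopic α β := by
  rintro ⟨y, β, hβ, ⟨H⟩⟩
  refine hα ?_
  obtain ⟨p, hp, hpX⟩ := not_subset.1 hUX
  have hUc : IsClosed U := by
    have : CompactSpace U := hU.some.symm.compactSpace
    exact (isCompact_iff_compactSpace.2 this).isClosed
  have hTE : TietzeExtension.{0} Plane := RCLike.instTietzeExtensionTVS (𝕜 := ℝ)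
  obtain ⟨F, hF, hFr⟩ := exists_radial_extension
    (⟨fun q => (H q : Plane), by fun_prop⟩ : C(I × I, Plane)) (fun s => by
      exact congrArg Subtype.val (H.prop' s))
  replace hF : ∀ s t : I, F (((1 - s / 2 : ℝ) : ℂ) *
      Complex.exp ((2 * Real.pi * t : ℝ) * Complex.I)) = (H (s, t) : Plane) := hF
  have hH0 : ∀ t, H (0, t) = α t := fun t => H.apply_zero t
  have hH1 : ∀ t, H (1, t) = β t := fun t => H.apply_one t
  have hFX' : ∀ z : ℂ, 1 / 2 ≤ ‖z‖ → ‖z‖ ≤ 1 → F z ∈ X := fun z h1 h2 => by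
    obtain ⟨t, ht⟩ := Complex.exists_eq_norm_mul_exp z
    have := hF ⟨2 * (1 - ‖z‖), by linarith, by linarith⟩ t
    rw [show (1 - 2 * (1 - ‖z‖) / 2 : ℝ) = ‖z‖ by ring, ← ht] at this
    rw [this]
    exact Subtype.coe_prop _
  have hF1 : ∀ z : ℂ, 1 ≤ ‖z‖ → F z ∈ interior U := fun z h1 => by
    obtain ⟨t, ht⟩ := Complex.exists_eq_norm_mul_exp (unitDiskRetraction z)
    have := hF 0 t
    rw [norm_unitDiskRetraction_of_le h1] at ht
    rw [show (1 - ((0 : I) : ℝ) / 2 : ℝ) = 1 by simp, ← ht, hH0, hFr] at this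
    rw [this]
    exact hαU t
  have hF2 : ∀ z : ℂ, ‖z‖ = 1 / 2 → F z ∉ U := fun z h1 => by
    obtain ⟨t, ht⟩ := Complex.exists_eq_norm_mul_exp z
    have := hF 1 t
    rw [show (1 - ((1 : I) : ℝ) / 2 : ℝ) = ‖z‖ by rw [h1]; norm_num, ← ht, hH1] at this
    rw [this]
    exact hβ t
  have hFX : ∀ z : ℂ, 1 / 2 ≤ ‖z‖ → F z ∈ X := fun z h1 => by
    rcases le_total ‖z‖ 1 with h | h
    · exact hFX' z h1 h
    · rw [← hFr]
      have := norm_unitDiskRetraction_of_le h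
      exact hFX' _ (by rw [this]; norm_num) this.le
  let K : Set ℂ := F ⁻¹' frontier U ∩ (norm ⁻¹' Icc (1 / 2) 1)
  have hKc : IsClosed K :=
    (isClosed_frontier.preimage F.continuous).inter (isClosed_Icc.preimage continuous_norm)
  have hK : IsCompact K := (isCompact_closedBall (0 : ℂ) 1).of_isClosed_subset hKc
    fun z hz => mem_closedBall_zero_iff.2 hz.2.2
  have hsep : ¬ JoinedIn Kᶜ 1 0 := fun hj => by
    -- The frontier of this open set lies in K: F maps the inner circle off U and everything beyond
    -- the outer one into the interior.
    obtain ⟨z, hzK, hz⟩ := hj.exists_mem_frontier (V := F ⁻¹' interior U ∩ norm ⁻¹' Ioi (1 / 2))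
      ⟨hF1 1 (by simp), by norm_num⟩ (fun h => by have := h.2; norm_num at this)
    have hVo : IsOpen (F ⁻¹' interior U ∩ norm ⁻¹' Ioi (1 / 2) : Set ℂ) :=
      (isOpen_interior.preimage F.continuous).inter (isOpen_Ioi.preimage continuous_norm)
    have hcl := closure_inter_subset_inter_closure _ _ hz.1
    have hzU : F z ∈ U := closure_minimal (t := F ⁻¹' U) (preimage_mono interior_subset)
      (hUc.preimage F.continuous) hcl.1
    have hz2 : 1 / 2 ≤ ‖z‖ := closure_minimal (t := norm ⁻¹' Ici (1 / 2))
      (preimage_mono Ioi_subset_Ici_self) (isClosed_Ici.preimage continuous_norm) hcl.2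
    have hz2' : 1 / 2 < ‖z‖ := hz2.lt_of_ne fun h => hF2 z h.symm hzU
    have hzi : F z ∉ interior U := fun h => hz.2 (by rw [hVo.interior_eq]; exact ⟨h, hz2'⟩)
    have hz1 : ‖z‖ ≤ 1 := not_lt.1 fun h => hzi (hF1 z h.le)
    exact hzK ⟨⟨subset_closure hzU, hzi⟩, hz2, hz1⟩
  obtain ⟨C, hCK, hCc, hCp, hCsep⟩ := hK.exists_isPreconnected_separator hsep
  have hCX : ∀ z ∈ C, F z ∈ X := fun z hz => hFX z (hCK hz).2.1
  have hV : ∀ z ∈ pathComponentIn Cᶜ 1, F z ∈ X := fun z hz => hFX z (by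
    -- The disk |z| < 1/2 misses C, so a point of it in the component would join 1 to 0.
    by_contra! h
    refine hCsep (JoinedIn.trans hz ?_)
    refine ((convex_ball (0 : ℂ) (1 / 2)).isPathConnected ⟨0, by simp⟩ |>.joinedIn z
      (by simpa using h) 0 (by simp)).mono fun w hw hwC => ?_
    exact (mem_ball_zero_iff.1 hw).not_ge (hCK hwC).2.1)
  obtain ⟨G, hG⟩ := exists_extension_of_separator hU hp F hCc hCp
    (fun z hz => ⟨(hCK hz).1, fun h => hpX (h ▸ hCX z hz)⟩) hCX hCsep hV
  refine Path.Homotopic.refl_of_extends α G fun t => ?_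
  have hmem : Complex.exp ((2 * Real.pi * t : ℝ) * Complex.I) ∈ pathComponentIn Cᶜ 1 := by
    let γ : Path (1 : ℂ) (Complex.exp ((2 * Real.pi * t : ℝ) * Complex.I)) :=
      { toFun := fun s => Complex.exp ((2 * Real.pi * t * s : ℝ) * Complex.I)
        continuous_toFun := by fun_prop
        source' := by simp
        target' := by simp }
    exact ⟨γ, fun s hs => (hCK hs).1.2 (hF1 _ (Complex.norm_exp_ofReal_mul_I _).ge)⟩
  refine Subtype.ext ((hG _ hmem).trans ?_)
  have := hF 0 t
  rw [hH0] at this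
  simpa using this
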